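/- Let $F$ be a number field with ring of adeles $\mathbf A$. For a place $v$ let $|\cdot|_v$ be the normalized absolute value on $F_v$ (the multiplier of Haar measure), let $q_v$ be the cardinality of the residue field if $v$ is finite, and put $q_v=e$ if $v$ is archimedean. Let $T$ be a split algebraic torus over $F$ with character group $M=X^*(T)$, let $N=\mathrm{Hom}(M,\mathbf Z)$, and let $\Sigma$ be a complete regular fan in $N_{\mathbf R}=\mathrm{Hom}(M,\mathbf R)$ (a finite fan covering $N_{\mathbf R}$, each of whose cones is generated by part of a $\mathbf Z$-basis of $N$). Let $\Sigma_1\subset N$ be the set of primitive integral generators of the one-dimensional cones of $\Sigma$. For $k=\mathbf R,\mathbf C$ let $PL(\Sigma)_k$ be the finite-dimensional $k$-vector space of functions $N_{\mathbf R}\to k$ whose restriction to each cone of $\Sigma$ is the restriction of an $\mathbf R$-linear function; let $\mathrm{Re}\,\varphi\in PL(\Sigma)_{\mathbf R}$ be the real part of $\varphi\in PL(\Sigma)_{\mathbf C}$. Put $PL(\Sigma)^+=\{\varphi\in PL(\Sigma)_{\mathbf R} : \varphi(e)>0 \text{ for all } e\in\Sigma_1\}$ and let $\varphi_\Sigma\in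 PL(\Sigma)_{\mathbf R}$ be the function with $\varphi_\Sigma(e)=1$ for all $e\in\Sigma_1$. For $x\in T(F_v)$ let $\overline{x}\in N_{\mathbf R}$ be the map $m\mapsto -\log|m(x)|_v/\log q_v$. For $\varphi\in PL(\Sigma)_{\mathbf C}$ and $x=(x_v)_v\in T(\mathbf A)$ put $$H_\Sigma(x,\varphi)=\prod_v e^{-\varphi(\overline{x_v})\log q_v},$$ where almost all factors are equal to $1$. Then the series $$\sum_{x\in T(F)}H_\Sigma(xt,\varphi)$$ converges absolutely and uniformly for $(\mathrm{Re}\,\varphi,t)$ in any compact subset of $(\varphi_\Sigma+PL(\Sigma)^+)\times T(\mathbf A)$. That is, for every compact subset $K$ of $(\varphi_\Sigma+PL(\Sigma)^+)\times T(\mathbf A)$, both this series and the series $\sum_{x\in T(F)}|H_\Sigma(xt,\varphi)|$ of absolute values converge uniformly on the set of all $(\varphi,t)\in PL(\Sigma)_{\mathbf C}\times T(\mathbf A)$ with $(\mathrm{Re}\,\varphi,t)\in K$ (uniform convergence of the net of sums over finite subsets of $T(F)$). -/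

import Mathlib

open NumberField IsDedekindDomain
open scoped NumberField.AdeleRing Pointwise

noncomputable section

namespace ToricHeight

/-! ### The split torus with character lattice `M`

A split torus over `F` is `T = Spec F[M]`, where `M = X^*(T)` is a free abelian group of finite
rank.  For an `F`-algebra `R`, its group of `R`-points is `T(R) = Hom(M, Rˣ)`; the value of the
character `m` at the point `x` is `x (Multiplicative.ofAdd m)`. -/

/-- The group `T(R) = Hom(M, Rˣ)` of `R`-points of the split torus with character lattice `M`. -/
abbrev TorusPoints (M : Type*) [AddCommGroup M] (R : Type*) [CommRing R] : Type _ :=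
  Multiplicative M →* Rˣ

/-- If `R` is a topological ring, `T(R)` has the topology of pointwise convergence on characters,
where `Rˣ` has its usual unit topology.  A basis of `M` identifies `T(R)` with `(Rˣ) ^ d`. -/
instance torusPointsTopology (M : Type*) [AddCommGroup M] (R : Type*) [CommRing R]
    [TopologicalSpace R] : TopologicalSpace (TorusPoints M R) :=
  TopologicalSpace.induced (fun x => (fun m => x m : Multiplicative M → Rˣ)) inferInstance

/-- Functoriality `T(R) → T(S)` of points, for a ring homomorphism `R → S`. -/
def TorusPoints.map {M : Type*} [AddCommGroup M] {R S : Type*} [CommRing R] [CommRing S]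
    (f : R →+* S) : TorusPoints M R →* TorusPoints M S where
  toFun x := (Units.map (f : R →* S)).comp x
  map_one' := by ext; simp
  map_mul' x y := by ext; simp

/-! ### Lattices and fans -/

section Fan

/-- The cocharacter lattice `N = Hom(M, ℤ)`. -/
abbrev Coch (M : Type*) [AddCommGroup M] : Type _ := M →ₗ[ℤ] ℤ

/-- The real vector space `N_ℝ = Hom(M, ℝ)` (which is `N ⊗ ℝ` as `M` is free of finite rank). -/
abbrev CochR (M : Type*) [AddCommGroup M] : Type _ := M →ₗ[ℤ] ℝ

variable {M : Type*} [AddCommGroup M]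

/-- The inclusion of `N` in `N_ℝ`. -/
def Coch.toReal (n : Coch M) : CochR M := (Algebra.linearMap ℤ ℝ) ∘ₗ n

/-- `e ∈ N` is primitive: it is not a proper multiple of a lattice vector (in particular
`e ≠ 0`). -/
def Coch.IsPrimitive (e : Coch M) : Prop :=
  ∀ (k : ℤ) (f : Coch M), e = k • f → IsUnit k

variable (M) in
/-- A (finite) fan in `N_ℝ`: a finite set of strongly convex rational polyhedral cones, closed
under passing to faces, in which the intersection of two cones is a face of both. -/
structure Fan where
  /-- The cones of the fan. -/
  cones : Set (PointedCone ℝ (CochR M))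
  finite_cones : cones.Finite
  rational : ∀ σ ∈ cones, ∃ s : Finset (Coch M),
    σ = PointedCone.hull ℝ (Coch.toReal '' (s : Set (Coch M)))
  strongly_convex : ∀ σ ∈ cones, ∀ x ∈ σ, -x ∈ σ → x = 0
  face_mem : ∀ σ ∈ cones, ∀ τ : PointedCone ℝ (CochR M), τ.IsFaceOf σ → τ ∈ cones
  inter_isFaceOf : ∀ σ ∈ cones, ∀ τ ∈ cones, (σ ⊓ τ).IsFaceOf σ

namespace Fan

variable (Δ : Fan M)

/-- The fan covers `N_ℝ`. -/
def IsComplete : Prop := ∀ x : CochR M, ∃ σ ∈ Δ.cones, x ∈ σ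

/-- Every cone of the fan is generated by a part of a `ℤ`-basis of the lattice `N`. -/
def IsRegular : Prop :=
  ∀ σ ∈ Δ.cones, ∃ (b : Module.Basis (Fin (Module.finrank ℤ (Coch M))) ℤ (Coch M))
    (s : Set (Fin (Module.finrank ℤ (Coch M)))),
      σ = PointedCone.hull ℝ ((fun i => (b i).toReal) '' s)

/-- `Σ₁`: the primitive integral generators of the one-dimensional cones of the fan. -/
def rays : Set (Coch M) := {e | e.IsPrimitive ∧ PointedCone.hull ℝ {e.toReal} ∈ Δ.cones}

/-- For `𝕜 = ℝ` or `ℂ`, the `𝕜`-vector space `PL(Σ)_𝕜` of `𝕜`-valued functions on `N_ℝ` whose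
restriction to every cone of the fan is the restriction of a linear function. -/
def PL (𝕜 : Type*) [RCLike 𝕜] : Submodule 𝕜 (CochR M → 𝕜) where
  carrier := {φ | ∀ σ ∈ Δ.cones, ∃ l : CochR M →ₗ[ℝ] 𝕜, ∀ n ∈ σ, φ n = l n}
  zero_mem' := fun _ _ => ⟨0, fun _ _ => rfl⟩
  add_mem' := by
    intro φ ψ hφ hψ σ hσ
    obtain ⟨l, hl⟩ := hφ σ hσ
    obtain ⟨k, hk⟩ := hψ σ hσ
    exact ⟨l + k, fun n hn => by simp [hl n hn, hk n hn]⟩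
  smul_mem' := by
    intro c φ hφ σ hσ
    obtain ⟨l, hl⟩ := hφ σ hσ
    exact ⟨c • l, fun n hn => by simp [hl n hn]⟩

/-- The real part `Re φ ∈ PL(Σ)_ℝ` of `φ ∈ PL(Σ)_ℂ`. -/
def PL.re {Δ : Fan M} (φ : Δ.PL ℂ) : Δ.PL ℝ :=
  ⟨fun n => (φ.1 n).re, by
    intro σ hσ
    obtain ⟨l, hl⟩ := φ.2 σ hσ
    exact ⟨Complex.reLm ∘ₗ l, fun n hn => by simp [hl n hn]⟩⟩

/-- The open cone `PL(Σ)^+` of all `φ ∈ PL(Σ)_ℝ` with `φ(e) > 0` for all `e ∈ Σ₁`. -/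
def PLpos : Set (Δ.PL ℝ) := {φ | ∀ e ∈ Δ.rays, 0 < φ.1 e.toReal}

/-! The function `φ_Σ` with value `1` on all `e ∈ Σ₁`: it exists on a regular fan. -/

lemma toReal_apply (n : Coch M) (m : M) : n.toReal m = (n m : ℝ) := rfl

lemma toReal_injective : Function.Injective (Coch.toReal (M := M)) := by
  intro a b h
  ext m
  have := LinearMap.congr_fun h m
  simpa [toReal_apply] using this

/-- Evaluation at `m ∈ M`, as a linear function on `N_ℝ`. -/
def evalAt (m : M) : CochR M →ₗ[ℝ] ℝ where
  toFun n := n m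
  map_add' _ _ := rfl
  map_smul' _ _ := rfl

lemma mem_hull_iff {ι : Type*} [Fintype ι] [DecidableEq ι] {b : Module.Basis ι ℤ (Coch M)}
    {m : ι → M} (hb : ∀ i j, b i (m j) = if i = j then 1 else 0)
    (hx : ∀ x : CochR M, x = ∑ j, x (m j) • (b j).toReal) (s : Set ι) (x : CochR M) :
    x ∈ PointedCone.hull ℝ ((fun i => (b i).toReal) '' s) ↔
      (∀ j, 0 ≤ x (m j)) ∧ ∀ j, j ∉ s → x (m j) = 0 := by
  constructor
  · intro h
    induction h using Submodule.span_induction with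
    | mem y hy =>
      obtain ⟨i, hi, rfl⟩ := hy
      refine ⟨fun j => ?_, fun j hj => ?_⟩
      · simp only [toReal_apply, hb]; split_ifs <;> simp
      · have : i ≠ j := fun h => hj (h ▸ hi)
        simp [toReal_apply, hb, this]
    | zero => simp
    | add y z _ _ h1 h2 =>
      refine ⟨fun j => add_nonneg (h1.1 j) (h2.1 j), fun j hj => ?_⟩
      simp [h1.2 j hj, h2.2 j hj]
    | smul a y _ h1 =>
      refine ⟨fun j => mul_nonneg a.2 (h1.1 j), fun j hj => ?_⟩
      have : (a • y) (m j) = (a : ℝ) * y (m j) := rfl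
      simp [this, h1.2 j hj]
  · rintro ⟨h0, h1⟩
    rw [hx x]
    refine Submodule.sum_mem _ fun j _ => ?_
    by_cases hj : j ∈ s
    · exact Submodule.smul_mem _ (⟨x (m j), h0 j⟩ : {c : ℝ // 0 ≤ c})
        (Submodule.subset_span ⟨j, hj, rfl⟩)
    · rw [h1 j hj, zero_smul]; exact Submodule.zero_mem _

lemma primitive_basis {ι : Type*} [Fintype ι] [DecidableEq ι] {b : Module.Basis ι ℤ (Coch M)}
    {m : ι → M} (hb : ∀ i j, b i (m j) = if i = j then 1 else 0) (i : ι) :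
    (b i).IsPrimitive := by
  intro k f h
  have := LinearMap.congr_fun h (m i)
  simp only [hb, if_true, LinearMap.smul_apply, smul_eq_mul] at this
  exact IsUnit.of_mul_eq_one _ this.symm

/-- The generators of a cone of a regular fan given by a basis are the rays it contains. -/
lemma basis_mem_rays {ι : Type*} [Fintype ι] [DecidableEq ι] {b : Module.Basis ι ℤ (Coch M)}
    {m : ι → M} (hb : ∀ i j, b i (m j) = if i = j then 1 else 0)
    (hx : ∀ x : CochR M, x = ∑ j, x (m j) • (b j).toReal) {s : Set ι}
    (hσ : PointedCone.hull ℝ ((fun i => (b i).toReal) '' s) ∈ Δ.cones) {i : ι} (hi : i ∈ s) :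
    b i ∈ Δ.rays := by
  refine ⟨primitive_basis hb i, Δ.face_mem _ hσ _ ?_⟩
  have key := mem_hull_iff hb hx {i}
  simp only [Set.image_singleton] at key
  constructor
  · refine Submodule.span_mono ?_
    rintro _ rfl
    exact ⟨i, hi, rfl⟩
  · intro x y a hxs hys ha hxy
    rw [mem_hull_iff hb hx] at hxs hys
    rw [key] at hxy ⊢
    refine ⟨hxs.1, fun j hj => ?_⟩
    have h1 : a * x (m j) + y (m j) = 0 := hxy.2 j hj
    have h2 := hys.1 j
    have h3 := hxs.1 j
    have h4 : a * x (m j) = 0 := by nlinarith [mul_nonneg ha.le h3]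
    exact (mul_eq_zero.1 h4).resolve_left ha.ne'

lemma ray_eq_basis {ι : Type*} [Fintype ι] [DecidableEq ι] {b : Module.Basis ι ℤ (Coch M)}
    {m : ι → M} (hb : ∀ i j, b i (m j) = if i = j then 1 else 0)
    (hx : ∀ x : CochR M, x = ∑ j, x (m j) • (b j).toReal) {s : Set ι}
    (hσ : PointedCone.hull ℝ ((fun i => (b i).toReal) '' s) ∈ Δ.cones) {e : Coch M}
    (he : e ∈ Δ.rays)
    (hes : e.toReal ∈ PointedCone.hull ℝ ((fun i => (b i).toReal) '' s)) :
    ∃ i ∈ s, e = b i := by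
  obtain ⟨hp, hρ⟩ := he
  have hF := Δ.inter_isFaceOf _ hσ _ hρ
  have hmem := (mem_hull_iff hb hx s _).1 hes
  have hne : ∃ i, e.toReal (m i) ≠ 0 := by
    by_contra hcon
    push Not at hcon
    have h0 : e.toReal = 0 := by rw [hx e.toReal]; simp [hcon]
    have h1 : e = 0 := toReal_injective (by rw [h0]; ext; simp [toReal_apply])
    have := hp 0 0 (by simp [h1])
    simp at this
  obtain ⟨i, hi⟩ := hne
  have his : i ∈ s := by
    by_contra h
    exact hi (hmem.2 i h)
  have hpos : 0 < e.toReal (m i) := lt_of_le_of_ne (hmem.1 i) (Ne.symm hi)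
  have hbi : (b i).toReal ∈ PointedCone.hull ℝ ((fun i => (b i).toReal) '' s) :=
    Submodule.subset_span ⟨i, his, rfl⟩
  have hbρ : (b i).toReal ∈ PointedCone.hull ℝ {e.toReal} := by
    have hyσ : (e.toReal - e.toReal (m i) • (b i).toReal) ∈
        PointedCone.hull ℝ ((fun i => (b i).toReal) '' s) := by
      rw [mem_hull_iff hb hx]
      have hval : ∀ j, (e.toReal - e.toReal (m i) • (b i).toReal) (m j) =
          if i = j then 0 else e.toReal (m j) := by
        intro j
        simp only [LinearMap.sub_apply, LinearMap.smul_apply, toReal_apply, hb, smul_eq_mul]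
        split_ifs with h
        · subst h; simp
        · simp
      refine ⟨fun j => ?_, fun j hj => ?_⟩
      · rw [hval]; split_ifs
        · exact le_rfl
        · exact hmem.1 j
      · rw [hval]; split_ifs
        · rfl
        · exact hmem.2 j hj
    refine (hF.mem_of_smul_add_mem hbi hyσ hpos ?_).2
    rw [add_sub_cancel]
    exact ⟨hes, Submodule.subset_span rfl⟩
  obtain ⟨c, hc⟩ := Submodule.mem_span_singleton.1 hbρ
  have hc' : ∀ μ : M, (c : ℝ) * (e μ : ℝ) = (b i μ : ℝ) := fun μ => LinearMap.congr_fun hc μ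
  have h1 : (c : ℝ) * (e (m i) : ℝ) = 1 := by rw [hc', hb]; simp
  have h2 : e = e (m i) • b i := by
    ext μ
    have : (e μ : ℝ) = (e (m i) : ℝ) * (b i μ : ℝ) := by
      rw [← hc' μ, ← mul_assoc, mul_comm (e (m i) : ℝ), h1, one_mul]
    simpa using (by exact_mod_cast this : e μ = e (m i) * b i μ)
  have h3 : 0 < e (m i) := by
    have : (0 : ℝ) < (e (m i) : ℝ) := hpos
    exact_mod_cast this
  rcases Int.isUnit_iff.1 (hp _ _ h2) with h | h
  · exact ⟨i, his, by rw [h2, h, one_smul]⟩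
  · omega

section

variable [Module.Free ℤ M] [Module.Finite ℤ M]

lemma exists_dual {ι : Type*} [Fintype ι] [DecidableEq ι] (b : Module.Basis ι ℤ (Coch M)) :
    ∃ m : ι → M, (∀ i j, b i (m j) = if i = j then 1 else 0) ∧
      ∀ x : CochR M, x = ∑ j, x (m j) • (b j).toReal := by
  let c : Module.Basis ι ℤ M := b.dualBasis.map (Module.evalEquiv ℤ M).symm
  have hc : ∀ i j, b i (c j) = if i = j then 1 else 0 := by
    intro i j
    have h1 : b i (c j) = Module.evalEquiv ℤ M (c j) (b i) := rfl
    rw [h1]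
    simp only [c, Module.Basis.map_apply, LinearEquiv.apply_symm_apply]
    rw [Module.Basis.dualBasis_apply_self]
  refine ⟨c, hc, fun x => c.ext fun i => ?_⟩
  simp [LinearMap.sum_apply, toReal_apply, hc]

lemma exists_one_on_rays (hΔ : Δ.IsRegular) :
    ∃ φ : Δ.PL ℝ, ∀ e ∈ Δ.rays, φ.1 e.toReal = 1 := by
  classical
  have hl : ∀ σ ∈ Δ.cones, ∃ l : CochR M →ₗ[ℝ] ℝ, ∀ e ∈ Δ.rays, e.toReal ∈ σ → l e.toReal = 1 := by
    intro σ hσ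
    obtain ⟨b, s, rfl⟩ := hΔ σ hσ
    obtain ⟨m, hb, hx⟩ := exists_dual b
    refine ⟨∑ j, evalAt (m j), fun e he hes => ?_⟩
    obtain ⟨i, -, rfl⟩ := Δ.ray_eq_basis hb hx hσ he hes
    simp [evalAt, toReal_apply, hb]
  choose! l hl using hl
  have agree : ∀ σ ∈ Δ.cones, ∀ τ ∈ Δ.cones, ∀ n, n ∈ σ → n ∈ τ → l σ n = l τ n := by
    intro σ hσ τ hτ n hnσ hnτ
    have hστ : σ ⊓ τ ∈ Δ.cones := Δ.face_mem σ hσ _ (Δ.inter_isFaceOf σ hσ τ hτ)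
    have hn : n ∈ σ ⊓ τ := ⟨hnσ, hnτ⟩
    obtain ⟨b, s, hbs⟩ := hΔ _ hστ
    obtain ⟨m, hb, hx⟩ := exists_dual b
    rw [hbs] at hn hστ
    have hle : PointedCone.hull ℝ ((fun i => (b i).toReal) '' s) ≤ σ ⊓ τ := hbs.ge
    have h0 := (mem_hull_iff hb hx s n).1 hn
    rw [hx n, map_sum, map_sum]
    refine Finset.sum_congr rfl fun j _ => ?_
    by_cases hj : j ∈ s
    · have hr := Δ.basis_mem_rays hb hx hστ hj
      have hm := hle (Submodule.subset_span ⟨j, hj, rfl⟩)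
      rw [map_smul, map_smul, hl σ hσ _ hr hm.1, hl τ hτ _ hr hm.2]
    · simp [h0.2 j hj]
  let φ : CochR M → ℝ := fun n => if h : ∃ σ ∈ Δ.cones, n ∈ σ then l h.choose n else 0
  have hφ : ∀ σ ∈ Δ.cones, ∀ n ∈ σ, φ n = l σ n := by
    intro σ hσ n hn
    have h : ∃ σ ∈ Δ.cones, n ∈ σ := ⟨σ, hσ, hn⟩
    simp only [φ, dif_pos h]
    exact agree _ h.choose_spec.1 _ hσ n h.choose_spec.2 hn
  refine ⟨⟨φ, fun σ hσ => ⟨l σ, hφ σ hσ⟩⟩, fun e he => ?_⟩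
  have hm : e.toReal ∈ PointedCone.hull ℝ {e.toReal} := Submodule.subset_span rfl
  exact (hφ _ he.2 _ hm).trans (hl _ he.2 e he hm)

/-- The function `φ_Σ ∈ PL(Σ)_ℝ` of a regular fan, with `φ_Σ(e) = 1` for all `e ∈ Σ₁`.  On a
complete fan it is the only one. -/
def phiSigma (hΔ : Δ.IsRegular) : Δ.PL ℝ := (Δ.exists_one_on_rays hΔ).choose

lemma phiSigma_apply (hΔ : Δ.IsRegular) {e : Coch M} (he : e ∈ Δ.rays) :
    (Δ.phiSigma hΔ).1 e.toReal = 1 := (Δ.exists_one_on_rays hΔ).choose_spec e he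

end

end Fan

end Fan

/-! ### Local and global heights on the torus -/

section Height

variable {M : Type*} [AddCommGroup M] {F : Type*} [Field F] [NumberField F]

/-- The element `x̄` of `N_ℝ` attached to a point `x ∈ T(K)` over a field `K` with absolute value
`ν` and a real number `q`: it maps `m` to `- log (ν (m(x))) / log q`. -/
def logMap {K : Type*} [Field K] (ν : K →*₀ ℝ) (q : ℝ) (x : TorusPoints M K) : CochR M :=
  AddMonoidHom.toIntLinearMap
    { toFun := fun m => -Real.log (ν (x (Multiplicative.ofAdd m) : Kˣ)) / Real.log q
      map_zero' := by simp
      map_add' := fun m n => by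
        rw [ofAdd_add, map_mul, Units.val_mul, map_mul, Real.log_mul
          ((map_ne_zero ν).2 (Units.ne_zero _)) ((map_ne_zero ν).2 (Units.ne_zero _))]
        ring }

/-- The normalized absolute value of `F_v` for an archimedean place `v`: the usual one if `v` is
real, and its square if `v` is complex. -/
def infAbs (v : InfinitePlace F) : v.Completion →*₀ ℝ where
  toFun x := ‖x‖ ^ v.mult
  map_zero' := by simp [v.mult_ne_zero]
  map_one' := by simp
  map_mul' x y := by simp [mul_pow]

/-- The normalized absolute value of `F_v` for a finite place `v`, for which a local uniformizer
has absolute value `q_v⁻¹`. -/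
def finAbs (v : HeightOneSpectrum (𝓞 F)) : v.adicCompletion F →*₀ ℝ := normHom

/-- The cardinality `q_v` of the residue field at a finite place `v`. -/
def residueCard (v : HeightOneSpectrum (𝓞 F)) : ℝ := (Ideal.absNorm v.asIdeal : ℝ)

/-- The projection `𝔸 → F_v`, for an archimedean place `v`. -/
def projInf (v : InfinitePlace F) : 𝔸[F] →+* v.Completion where
  toFun a := a.1 v
  map_zero' := rfl
  map_one' := rfl
  map_add' _ _ := rfl
  map_mul' _ _ := rfl

/-- The projection `𝔸 → F_v`, for a finite place `v`. -/
def projFin (v : HeightOneSpectrum (𝓞 F)) : 𝔸[F] →+* v.adicCompletion F where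
  toFun a := a.2 v
  map_zero' := rfl
  map_one' := rfl
  map_add' _ _ := rfl
  map_mul' _ _ := rfl

variable {Δ : Fan M}

/-- The local height `H_{Σ,v}(x, φ) = exp(- φ(x̄) log q_v)` on `T(F_v)` at an archimedean place
`v`, where `q_v = e`. -/
def localHeightInf (v : InfinitePlace F) (x : TorusPoints M v.Completion) (φ : Δ.PL ℂ) : ℂ :=
  Complex.exp (-(φ.1 (logMap (infAbs v) (Real.exp 1) x)) * (Real.log (Real.exp 1) : ℂ))

/-- The local height `H_{Σ,v}(x, φ) = exp(- φ(x̄) log q_v)` on `T(F_v)` at a finite place `v`. -/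
def localHeightFin (v : HeightOneSpectrum (𝓞 F)) (x : TorusPoints M (v.adicCompletion F))
    (φ : Δ.PL ℂ) : ℂ :=
  Complex.exp (-(φ.1 (logMap (finAbs v) (residueCard v) x)) * (Real.log (residueCard v) : ℂ))

/-- The global height `H_Σ(x, φ) = ∏_v H_{Σ,v}(x_v, φ)` on `T(𝔸)`; almost all factors are `1`. -/
def height (x : TorusPoints M 𝔸[F]) (φ : Δ.PL ℂ) : ℂ :=
  (∏ v : InfinitePlace F, localHeightInf v (TorusPoints.map (projInf v) x) φ) *
    ∏ᶠ v : HeightOneSpectrum (𝓞 F), localHeightFin v (TorusPoints.map (projFin v) x) φ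

/-- Only finitely many finite places contribute to the product defining the global height. -/
lemma finite_mulSupport_localHeightFin [Module.Free ℤ M] [Module.Finite ℤ M]
    (φ : Δ.PL ℂ) (hc : Δ.IsComplete) (x : TorusPoints M 𝔸[F]) :
    (Function.mulSupport fun v : HeightOneSpectrum (𝓞 F) =>
      localHeightFin v (TorusPoints.map (projFin v) x) φ).Finite := by
  have h0 : φ.1 0 = 0 := by
    obtain ⟨σ, hσ, h⟩ := hc 0
    obtain ⟨l, hl⟩ := φ.2 σ hσ
    rw [hl 0 h, map_zero]
  let b := Module.Free.chooseBasis ℤ M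
  have h : ∀ i, ∀ᶠ v in Filter.cofinite,
      ‖((x (Multiplicative.ofAdd (b i)) : 𝔸[F]ˣ) : 𝔸[F]).2 v‖ = 1 := by
    intro i
    let snd : 𝔸[F] →* FiniteAdeleRing (𝓞 F) F :=
      { toFun := fun a => a.2, map_one' := rfl, map_mul' := fun _ _ => rfl }
    let u : (FiniteAdeleRing (𝓞 F) F)ˣ := Units.map snd (x (Multiplicative.ofAdd (b i)))
    filter_upwards [(FiniteAdeleRing.isUnit_iff.1 u.isUnit).2] with v hv
    rw [FinitePlace.norm_def]
    change ((WithZeroMulInt.toNNReal _ (Valued.v ((u : FiniteAdeleRing (𝓞 F) F) v)) : NNReal) : ℝ) = 1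
    rw [hv]; simp
  rw [← Filter.eventually_all] at h
  refine (Filter.eventually_cofinite.1 h).subset fun v hv hh => hv ?_
  have : logMap (finAbs v) (residueCard v) (TorusPoints.map (projFin v) x) = 0 := by
    refine b.ext fun i => ?_
    have h2 := hh i
    change -Real.log ‖((x (Multiplicative.ofAdd (b i)) : 𝔸[F]ˣ) : 𝔸[F]).2 v‖ / _ = 0
    rw [h2]; simp
  simp [localHeightFin, this, h0]

end Height

/-- The diagonal embedding `T(F) → T(𝔸)`. -/
def diag (M : Type*) [AddCommGroup M] (F : Type*) [Field F] [NumberField F] :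
    TorusPoints M F →* TorusPoints M 𝔸[F] := TorusPoints.map (algebraMap F 𝔸[F])

end ToricHeight

end

open ToricHeight

/-! The series is compared with a series over all local data, and that series factors over the
places.

If `Re φ` runs through a compact set, its values on the finitely many rays are at least some `s >
1`. Every vector of `N_ℝ` is a nonnegative combination of rays of one cone, on which `φ` is linear,
so `Re φ ≥ s φ_Σ` everywhere (`Fan.mul_phiSigma_le`). Moreover `φ_Σ` dominates a norm
(`Fan.exists_le_phiSigma`) and is at least `1` on nonzero lattice vectors (`Fan.one_le_phiSigma`).
Hence `norm_height_le` bounds the height by exponential decay in the archimedean coordinates times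
`∏ q_v ^ (-s φ_Σ(n_v))`, with `n_v ∈ N` the vectors at the finite places.

Send `x ∈ T(F)` to the floors of the archimedean coordinates of `xt` together with the family
`(n_v)_v`. Two points of one fibre differ by a point with trivial divisor and bounded archimedean
coordinates. Its coordinates are algebraic integers with bounded conjugates, so there are finitely
many such points (`finite_bounded_units`), and the fibres are uniformly bounded. It thus suffices to
sum over all integer vectors and all finitely supported families in `N`. The first sum is a product
of geometric series. The second is bounded by an Euler product with factors `1 + O(q_v ^ (-s))`,
convergent for `s > 1`. Neither the unit theorem nor finiteness of the class group is needed.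

Near a given `t₀` the divisor of `t` is constant and its archimedean coordinates vary by at most
`1`, so the majorant changes by a bounded factor. Compactness then gives a single summable majorant,
and the Weierstrass M-test applies. -/

namespace ToricHeight

/-! ### Summation over bounded fibres and over products -/

theorem summable_of_card_fiber_le {X Z : Type*} {f : X → ℝ} {g : Z → ℝ} (Φ : X → Z) (C : ℕ)
    (hf : ∀ x, 0 ≤ f x) (hg : Summable g) (hg0 : ∀ z, 0 ≤ g z) (hfg : ∀ x, f x ≤ g (Φ x))
    (hC : ∀ z, ∀ S : Finset X, (∀ x ∈ S, Φ x = z) → S.card ≤ C) : Summable f := by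
  classical
  refine summable_of_sum_le (c := C * ∑' z, g z) hf fun S => ?_
  calc ∑ x ∈ S, f x ≤ ∑ x ∈ S, g (Φ x) := Finset.sum_le_sum fun x _ => hfg x
    _ = ∑ z ∈ S.image Φ, (S.filter fun x => Φ x = z).card • g z := Finset.sum_comp g Φ
    _ ≤ ∑ z ∈ S.image Φ, C * g z := by
        refine Finset.sum_le_sum fun z _ => ?_
        rw [nsmul_eq_mul]
        refine mul_le_mul_of_nonneg_right ?_ (hg0 z)
        exact_mod_cast hC z _ fun x hx => (Finset.mem_filter.1 hx).2
    _ = C * ∑ z ∈ S.image Φ, g z := by rw [Finset.mul_sum]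
    _ ≤ C * ∑' z, g z :=
        mul_le_mul_of_nonneg_left (hg.sum_le_tsum _ fun z _ => hg0 z) (Nat.cast_nonneg _)

/-- The convergence half of an Euler product: a finite partial sum is part of the expansion of a
finite product of factors `1 + a p`, which is at most `exp (∑ a p)`. -/
theorem summable_finsupp_prod {P N : Type*} [Zero N] {f : P → N → ℝ} {a : P → ℝ}
    (hf0 : ∀ p n, 0 ≤ f p n) (hf1 : ∀ p, f p 0 = 1) (ha : Summable a)
    (hfa : ∀ p, ∀ T : Finset N, 0 ∉ T → ∑ n ∈ T, f p n ≤ a p) :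
    Summable fun D : P →₀ N => D.prod f := by
  classical
  have ha0 : ∀ p, 0 ≤ a p := fun p => by simpa using hfa p ∅ (by simp)
  refine summable_of_sum_le (c := Real.exp (∑' p, a p))
    (fun D => Finset.prod_nonneg fun p _ => hf0 p _) fun S => ?_
  let P0 : Finset P := S.biUnion Finsupp.support
  -- The value `0` is always included, so that the term `f p 0 = 1` can be split off below and `hfa`
  -- applies to the rest.
  let t : P → Finset N := fun p => insert 0 (S.image fun D => D p)
  let j : (P →₀ N) → ∀ p ∈ P0, N := fun D p _ => D p
  have hsupp : ∀ D ∈ S, D.support ⊆ P0 := fun D hD => Finset.subset_biUnion_of_mem _ hD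
  have hj : Set.InjOn j S := by
    intro D hD E hE h
    ext p
    by_cases hp : p ∈ P0
    · exact congrFun (congrFun h p) hp
    · rw [Finsupp.notMem_support_iff.1 fun h => hp (hsupp D hD h),
        Finsupp.notMem_support_iff.1 fun h => hp (hsupp E hE h)]
  calc ∑ D ∈ S, D.prod f = ∑ D ∈ S, ∏ p ∈ P0.attach, f p.1 (j D p.1 p.2) := by
        refine Finset.sum_congr rfl fun D hD => ?_
        rw [Finsupp.prod_of_support_subset D (hsupp D hD) f fun p _ => hf1 p]
        exact (Finset.prod_attach P0 fun p => f p (D p)).symm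
    _ = ∑ E ∈ S.image j, ∏ p ∈ P0.attach, f p.1 (E p.1 p.2) := by
        rw [Finset.sum_image hj]
    _ ≤ ∑ E ∈ P0.pi t, ∏ p ∈ P0.attach, f p.1 (E p.1 p.2) := by
        refine Finset.sum_le_sum_of_subset_of_nonneg ?_
          fun E _ _ => Finset.prod_nonneg fun p _ => hf0 _ _
        intro E hE
        obtain ⟨D, hD, rfl⟩ := Finset.mem_image.1 hE
        refine Finset.mem_pi.2 fun p _ => Finset.mem_insert_of_mem ?_
        exact Finset.mem_image_of_mem (fun D : P →₀ N => D p) hD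
    _ = ∏ p ∈ P0, ∑ n ∈ t p, f p n := (Finset.prod_sum P0 t f).symm
    _ ≤ ∏ p ∈ P0, (1 + a p) := by
        refine Finset.prod_le_prod (fun p _ => Finset.sum_nonneg fun n _ => hf0 _ _) fun p _ => ?_
        rw [← Finset.add_sum_erase _ _ (Finset.mem_insert_self 0 _), hf1]
        exact add_le_add_right (hfa p _ (Finset.notMem_erase _ _)) 1
    _ ≤ Real.exp (∑ p ∈ P0, a p) := Real.prod_one_add_le_exp_sum _ fun p => ha0 p
    _ ≤ Real.exp (∑' p, a p) := Real.exp_le_exp.2 (ha.sum_le_tsum _ fun p _ => ha0 p)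

theorem summable_pi_prod {P N : Type*} [Fintype P] [Zero N] {f : P → N → ℝ}
    (hf0 : ∀ p n, 0 ≤ f p n) (hf1 : ∀ p, f p 0 = 1) (hf : ∀ p, Summable (f p)) :
    Summable fun D : P → N => ∏ p, f p (D p) := by
  have h := summable_finsupp_prod (a := fun p => ∑' n, f p n) hf0 hf1 (Summable.of_finite)
    fun p T _ => (hf p).sum_le_tsum T fun n _ => hf0 p n
  refine (Finsupp.equivFunOnFinite.symm.summable_iff.2 h).congr fun D => ?_
  simp [Finsupp.prod_fintype _ _ hf1]

theorem summable_exp_neg_mul_abs_int {c : ℝ} (hc : 0 < c) :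
    Summable fun k : ℤ => Real.exp (-(c * |(k : ℝ)|)) := by
  have h : Summable fun n : ℕ => Real.exp (-(c * |(n : ℝ)|)) := by
    simpa [mul_comm] using Real.summable_exp_nat_mul_iff.2 (neg_lt_zero.2 hc)
  exact Summable.of_nat_of_neg (by simpa using h) (by simpa using h)

/-! ### Convergence of the sum of `N(v) ^ (-s)` over the primes of `F` -/

section Primes

variable {F : Type*} [Field F] [NumberField F]

/-- Distinct primes above `p` are coprime, so their product divides `(p)`, of norm `p ^ [F : ℚ]`,
while each of them has norm divisible by `p`. -/
theorem card_le_finrank_of_absNorm_under_eq {p : ℕ} (S : Finset (HeightOneSpectrum (𝓞 F)))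
    (hS : ∀ v ∈ S, Ideal.absNorm (Ideal.under ℤ v.asIdeal) = p) :
    S.card ≤ Module.finrank ℤ (𝓞 F) := by
  rcases S.eq_empty_or_nonempty with rfl | ⟨w, hw⟩
  · simp
  have hp : p.Prime := by
    have : NeZero w.asIdeal := ⟨w.ne_bot⟩
    exact hS w hw ▸ Nat.absNorm_under_prime w.asIdeal
  have hdvd : ∏ v ∈ S, v.asIdeal ∣ Ideal.span {(p : 𝓞 F)} := by
    refine Finset.prod_dvd_of_coprime ?_ fun v hv => ?_
    · intro v _ w _ hvw
      exact Ideal.isCoprime_iff_sup_eq.2 (v.isMaximal.coprime_of_ne w.isMaximal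
        fun h => hvw (HeightOneSpectrum.ext h))
    · rw [Ideal.dvd_span_singleton, ← hS v hv]
      exact Int.absNorm_under_mem _
  have h1 := map_dvd Ideal.absNorm hdvd
  rw [map_prod, Ideal.absNorm_span_natCast] at h1
  have h2 : p ^ S.card ≤ ∏ v ∈ S, Ideal.absNorm v.asIdeal := by
    rw [← Finset.prod_const]
    refine Finset.prod_le_prod' fun v hv => ?_
    refine Nat.le_of_dvd (zero_lt_one.trans (HeightOneSpectrum.one_lt_absNorm v)) ?_
    exact hS v hv ▸ Int.absNorm_under_dvd_absNorm _
  exact (Nat.pow_le_pow_iff_right hp.one_lt).1 (h2.trans (Nat.le_of_dvd (pow_pos hp.pos _) h1))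

/-- The norm of `v` is at least the rational prime below it, and at most `[F : ℚ]` primes lie above
each, so the sum is compared with `∑ n ^ (-s)`. -/
theorem summable_absNorm_rpow {s : ℝ} (hs : 1 < s) :
    Summable fun v : HeightOneSpectrum (𝓞 F) => (Ideal.absNorm v.asIdeal : ℝ) ^ (-s) := by
  refine summable_of_card_fiber_le (fun v => Ideal.absNorm (Ideal.under ℤ v.asIdeal))
    (Module.finrank ℤ (𝓞 F)) (fun v => by positivity)
    (Real.summable_nat_rpow.2 (neg_lt_neg hs)) (fun n => by positivity) (fun v => ?_)
    fun p S hS => card_le_finrank_of_absNorm_under_eq S hS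
  have : NeZero v.asIdeal := ⟨v.ne_bot⟩
  have hp := Nat.absNorm_under_prime v.asIdeal
  refine Real.rpow_le_rpow_of_nonpos (by exact_mod_cast hp.pos) ?_ (by linarith)
  exact_mod_cast Nat.le_of_dvd (zero_lt_one.trans (HeightOneSpectrum.one_lt_absNorm v))
    (Int.absNorm_under_dvd_absNorm _)

end Primes

/-! ### Piecewise linear functions on a complete regular fan -/

namespace Fan

variable {M : Type*} [AddCommGroup M] [Module.Free ℤ M] [Module.Finite ℤ M] {Δ : Fan M}

/-- The coefficients are the coordinates in a `ℤ`-basis adapted to a cone containing `x`, hence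
integers if `x` is a lattice vector. This reduces estimates of piecewise linear functions to their
values on rays. -/
theorem exists_ray_decomposition (hreg : Δ.IsRegular) (hcomp : Δ.IsComplete) (x : CochR M) :
    ∃ (s : Finset (Fin (Module.finrank ℤ (Coch M)))) (e : Fin (Module.finrank ℤ (Coch M)) → Coch M)
      (a : Fin (Module.finrank ℤ (Coch M)) → ℝ), (∀ i ∈ s, e i ∈ Δ.rays) ∧ (∀ i, 0 ≤ a i) ∧
      x = ∑ i ∈ s, a i • (e i).toReal ∧
      (∀ φ : Δ.PL ℝ, φ.1 x = ∑ i ∈ s, a i * φ.1 (e i).toReal) ∧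
      ((∃ n : Coch M, n.toReal = x) → ∀ i, ∃ k : ℤ, a i = k) := by
  classical
  obtain ⟨σ, hσ, hxσ⟩ := hcomp x
  obtain ⟨b, s, rfl⟩ := hreg σ hσ
  obtain ⟨m, hb, hx⟩ := exists_dual b
  have hmem := (mem_hull_iff hb hx s x).1 hxσ
  have hsum : x = ∑ i ∈ s.toFinset, x (m i) • (b i).toReal := by
    conv_lhs => rw [hx x]
    symm
    refine Finset.sum_subset (Finset.subset_univ _) fun i _ hi => ?_
    rw [hmem.2 i (by simpa using hi), zero_smul]
  refine ⟨s.toFinset, b, fun i => x (m i), fun i hi => ?_, hmem.1, hsum, fun φ => ?_, ?_⟩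
  · exact Δ.basis_mem_rays hb hx hσ (by simpa using hi)
  · obtain ⟨l, hl⟩ := φ.2 _ hσ
    rw [hl x hxσ]
    conv_lhs => rw [hsum]
    rw [map_sum]
    refine Finset.sum_congr rfl fun i hi => ?_
    rw [map_smul, smul_eq_mul, hl _ (Submodule.subset_span ⟨i, by simpa using hi, rfl⟩)]
  · rintro ⟨n, rfl⟩ i
    exact ⟨n (m i), rfl⟩

/-- A ray generator lies in the cone it spans, so it belongs to the basis chosen for that cone, and
there are finitely many cones. -/
theorem finite_rays (hreg : Δ.IsRegular) : Δ.rays.Finite := by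
  choose b s hbs using hreg
  have := Δ.finite_cones.to_subtype
  refine (Set.finite_range fun p : (σ : Δ.cones) × Fin (Module.finrank ℤ (Coch M)) =>
    b p.1.1 p.1.2 p.2).subset fun e he => ?_
  obtain ⟨m, hb, hx⟩ := exists_dual (b _ he.2)
  obtain ⟨i, -, hi⟩ := Δ.ray_eq_basis hb hx (hbs _ he.2 ▸ he.2) he
    (hbs _ he.2 ▸ Submodule.subset_span rfl)
  exact ⟨⟨⟨_, he.2⟩, i⟩, hi.symm⟩

variable (hreg : Δ.IsRegular) (hcomp : Δ.IsComplete)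

include hcomp in
theorem mul_phiSigma_le {ψ : Δ.PL ℝ} {s : ℝ} (hψ : ∀ e ∈ Δ.rays, s ≤ ψ.1 e.toReal)
    (x : CochR M) : s * (Δ.phiSigma hreg).1 x ≤ ψ.1 x := by
  obtain ⟨S, e, a, he, ha, -, hφ, -⟩ := exists_ray_decomposition hreg hcomp x
  rw [hφ, hφ, Finset.mul_sum]
  refine Finset.sum_le_sum fun i hi => ?_
  rw [phiSigma_apply _ _ (he i hi), mul_one, mul_comm]
  exact mul_le_mul_of_nonneg_left (hψ _ (he i hi)) (ha i)

include hcomp in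
theorem phiSigma_zero : (Δ.phiSigma hreg).1 0 = 0 := by
  obtain ⟨σ, hσ, h⟩ := hcomp 0
  obtain ⟨l, hl⟩ := (Δ.phiSigma hreg).2 σ hσ
  rw [hl 0 h, map_zero]

include hcomp in
-- The value is the sum of the ray coefficients of `n`, which are nonnegative integers and not all
-- zero.
theorem one_le_phiSigma {n : Coch M} (hn : n ≠ 0) : 1 ≤ (Δ.phiSigma hreg).1 n.toReal := by
  obtain ⟨S, e, a, he, ha, hx, hφ, hint⟩ := exists_ray_decomposition hreg hcomp n.toReal
  have h1 : (Δ.phiSigma hreg).1 n.toReal = ∑ i ∈ S, a i := by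
    rw [hφ]
    exact Finset.sum_congr rfl fun i hi => by rw [phiSigma_apply _ _ (he i hi), mul_one]
  obtain ⟨i, hi, hai⟩ : ∃ i ∈ S, a i ≠ 0 := by
    by_contra! h
    refine hn (toReal_injective ?_)
    rw [hx, Finset.sum_eq_zero fun i hi => by rw [h i hi, zero_smul]]
    ext; simp [toReal_apply]
  rw [h1]
  refine le_trans ?_ (Finset.single_le_sum (fun i _ => ha i) hi)
  obtain ⟨k, hk⟩ := hint ⟨n, rfl⟩ i
  have : 0 < a i := lt_of_le_of_ne (ha i) (Ne.symm hai)
  rw [hk] at this ⊢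
  exact_mod_cast this

include hcomp in
/-- `φ_Σ` dominates a norm on `N_ℝ`. -/
theorem exists_le_phiSigma {ι : Type*} [Fintype ι] (m : ι → M) :
    ∃ c : ℝ, 0 < c ∧ ∀ x : CochR M, c * ∑ i, |x (m i)| ≤ (Δ.phiSigma hreg).1 x := by
  have hfin := finite_rays hreg
  -- `A` bounds the `ℓ¹`-norm of every ray generator; the summand `1` keeps it positive in all
  -- cases.
  let A : ℝ := 1 + ∑ e ∈ hfin.toFinset, ∑ i, |e.toReal (m i)|
  have hA : 0 < A := by positivity
  refine ⟨A⁻¹, inv_pos.2 hA, fun x => ?_⟩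
  rw [inv_mul_le_iff₀ hA]
  obtain ⟨S, e, a, he, ha, hx, hφ, -⟩ := exists_ray_decomposition hreg hcomp x
  have h1 : (Δ.phiSigma hreg).1 x = ∑ j ∈ S, a j := by
    rw [hφ]
    exact Finset.sum_congr rfl fun i hi => by rw [phiSigma_apply _ _ (he i hi), mul_one]
  have h2 : ∀ j ∈ S, ∑ i, |(e j).toReal (m i)| ≤ A := fun j hj => by
    have := Finset.single_le_sum (f := fun e : Coch M => ∑ i, |e.toReal (m i)|)
      (fun e _ => Finset.sum_nonneg fun i _ => abs_nonneg _) (hfin.mem_toFinset.2 (he j hj))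
    simp only [A]
    linarith
  calc ∑ i, |x (m i)| ≤ ∑ i, ∑ j ∈ S, a j * |(e j).toReal (m i)| := by
        refine Finset.sum_le_sum fun i _ => ?_
        conv_lhs => rw [hx]
        rw [LinearMap.sum_apply]
        refine (Finset.abs_sum_le_sum_abs _ _).trans (Finset.sum_le_sum fun j _ => ?_)
        rw [LinearMap.smul_apply, smul_eq_mul, abs_mul, abs_of_nonneg (ha j)]
    _ = ∑ j ∈ S, a j * ∑ i, |(e j).toReal (m i)| := by
        rw [Finset.sum_comm]
        simp_rw [Finset.mul_sum]
    _ ≤ ∑ j ∈ S, a j * A :=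
        Finset.sum_le_sum fun j hj => mul_le_mul_of_nonneg_left (h2 j hj) (ha j)
    _ = A * (Δ.phiSigma hreg).1 x := by rw [h1, ← Finset.sum_mul, mul_comm]

/-- For each ray the evaluation is continuous and attains its minimum on `K`, which exceeds `1`; the
least of these finitely many minima serves as `s`. -/
theorem exists_one_lt_forall_le {X : Type*} [TopologicalSpace X] {K : Set (Δ.PL ℝ × X)}
    (hK : IsCompact K) (hKsub : K ⊆ (Δ.phiSigma hreg +ᵥ Δ.PLpos) ×ˢ Set.univ) :
    ∃ s : ℝ, 1 < s ∧ ∀ p ∈ K, ∀ e ∈ Δ.rays, s ≤ p.1.1 e.toReal := by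
  rcases K.eq_empty_or_nonempty with rfl | hne
  · exact ⟨2, one_lt_two, by simp⟩
  have h : ∀ e ∈ Δ.rays, ∃ s : ℝ, 1 < s ∧ ∀ p ∈ K, s ≤ p.1.1 e.toReal := by
    intro e he
    have hcont : Continuous fun p : Δ.PL ℝ × X => p.1.1 e.toReal :=
      (continuous_apply e.toReal).comp (continuous_subtype_val.comp continuous_fst)
    obtain ⟨p, hp, hmin⟩ := hK.exists_isMinOn hne hcont.continuousOn
    refine ⟨_, ?_, fun q hq => hmin hq⟩
    obtain ⟨ψ, hψ, h⟩ := (hKsub hp).1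
    change 1 < p.1.1 e.toReal
    rw [← h]
    change 1 < (Δ.phiSigma hreg).1 e.toReal + ψ.1 e.toReal
    rw [phiSigma_apply _ _ he]
    linarith [hψ e he]
  choose! r hr1 hr using h
  have hfin := finite_rays hreg
  rcases Δ.rays.eq_empty_or_nonempty with h0 | h0
  · exact ⟨2, one_lt_two, by simp [h0]⟩
  obtain ⟨e, he, hmin⟩ := Set.exists_min_image _ r hfin h0
  exact ⟨r e, hr1 e he, fun p hp e' he' => (hmin e' he').trans (hr e' he' p hp)⟩

/-- The local sums `∑_{n ∈ N, n ≠ 0} q ^ (- s φ_Σ(n))` are `O(q ^ (-s))`. -/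
theorem exists_sum_rpow_phiSigma_le (hcomp : Δ.IsComplete) {s : ℝ} (hs : 0 < s) :
    ∃ C : ℝ, ∀ q : ℝ, 2 ≤ q → ∀ T : Finset (Coch M), 0 ∉ T →
      ∑ n ∈ T, Real.exp (-(s * (Δ.phiSigma hreg).1 n.toReal) * Real.log q) ≤ C * q ^ (-s) := by
  classical
  let b := Module.Free.chooseBasis ℤ M
  obtain ⟨c, hc, hφ⟩ := exists_le_phiSigma hreg hcomp b
  have hlog : 0 < Real.log 2 := Real.log_pos one_lt_two
  -- For `φ_Σ(n) ≥ 1` and `q ≥ 2`, `q ^ (-s φ_Σ(n)) ≤ q ^ (-s) * 2 ^ (-s (φ_Σ(n) - 1))`. Here `f` is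
  -- the last factor, so its sum is a constant independent of `q`.
  let f : Coch M → ℝ := fun n => Real.exp (-(s * ((Δ.phiSigma hreg).1 n.toReal - 1)) * Real.log 2)
  have hf : Summable f := by
    have h1 : Summable fun z : Module.Free.ChooseBasisIndex ℤ M → ℤ =>
        Real.exp (s * Real.log 2) *
          ∏ i, Real.exp (-((s * c * Real.log 2) * |(z i : ℝ)|)) :=
      (summable_pi_prod (f := fun _ (k : ℤ) => Real.exp (-((s * c * Real.log 2) * |(k : ℝ)|)))
        (fun _ _ => (Real.exp_pos _).le) (by simp)
        fun _ => summable_exp_neg_mul_abs_int (by positivity)).mul_left _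
    refine Summable.of_nonneg_of_le (fun _ => (Real.exp_pos _).le) (fun n => ?_)
      (h1.comp_injective (i := fun (n : Coch M) i => n (b i))
        fun n n' h => b.ext fun i => congrFun h i)
    simp only [f, Function.comp]
    rw [← Real.exp_sum, ← Real.exp_add, Real.exp_le_exp, Finset.sum_neg_distrib, ← Finset.mul_sum]
    have := mul_le_mul_of_nonneg_left (hφ n.toReal) (mul_pos hs hlog).le
    simp only [toReal_apply] at this
    linarith
  refine ⟨∑' n, f n, fun q hq T hT => ?_⟩
  have hq0 : 0 < q := by linarith
  calc _ ≤ ∑ n ∈ T, f n * q ^ (-s) := by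
        refine Finset.sum_le_sum fun n hn => ?_
        have h1 : 1 ≤ (Δ.phiSigma hreg).1 n.toReal :=
          one_le_phiSigma hreg hcomp fun h => hT (h ▸ hn)
        simp only [f]
        rw [Real.rpow_def_of_pos hq0, ← Real.exp_add, Real.exp_le_exp]
        have h2 : Real.log 2 ≤ Real.log q := Real.log_le_log two_pos hq
        have := mul_le_mul_of_nonneg_left h2 (mul_nonneg hs.le (sub_nonneg.2 h1))
        linarith
    _ = (∑ n ∈ T, f n) * q ^ (-s) := by rw [Finset.sum_mul]
    _ ≤ (∑' n, f n) * q ^ (-s) :=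
        mul_le_mul_of_nonneg_right (hf.sum_le_tsum _ fun n _ => (Real.exp_pos _).le) (by positivity)

end Fan

end ToricHeight

/-! ### Coordinates and divisors of adelic points -/

noncomputable section

namespace ToricHeight

variable {M : Type*} [AddCommGroup M] {F : Type*} [Field F] [NumberField F]

theorem logMap_mul {K : Type*} [Field K] (ν : K →*₀ ℝ) (q : ℝ) (x y : TorusPoints M K) :
    logMap ν q (x * y) = logMap ν q x + logMap ν q y := by
  ext m
  change -Real.log (ν ((x (Multiplicative.ofAdd m) * y (Multiplicative.ofAdd m) : Kˣ) : K)) / _ =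
    -Real.log (ν (x (Multiplicative.ofAdd m) : K)) / _ +
      -Real.log (ν (y (Multiplicative.ofAdd m) : K)) / _
  rw [Units.val_mul, map_mul, Real.log_mul ((map_ne_zero ν).2 (Units.ne_zero _))
    ((map_ne_zero ν).2 (Units.ne_zero _))]
  ring

/-- The vector `x̄_v ∈ N_ℝ` of an adelic point at an archimedean place. -/
def infCoord (v : InfinitePlace F) (x : TorusPoints M 𝔸[F]) : CochR M :=
  logMap (infAbs v) (Real.exp 1) (TorusPoints.map (projInf v) x)

/-- The vector `x̄_v ∈ N_ℝ` of an adelic point at a finite place. -/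
def finCoord (v : HeightOneSpectrum (𝓞 F)) (x : TorusPoints M 𝔸[F]) : CochR M :=
  logMap (finAbs v) (residueCard v) (TorusPoints.map (projFin v) x)

theorem infCoord_mul (v : InfinitePlace F) (x y : TorusPoints M 𝔸[F]) :
    infCoord v (x * y) = infCoord v x + infCoord v y := by
  simp only [infCoord, map_mul, logMap_mul]

theorem finCoord_mul (v : HeightOneSpectrum (𝓞 F)) (x y : TorusPoints M 𝔸[F]) :
    finCoord v (x * y) = finCoord v x + finCoord v y := by
  simp only [finCoord, map_mul, logMap_mul]

theorem infCoord_apply (v : InfinitePlace F) (x : TorusPoints M 𝔸[F]) (m : M) :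
    infCoord v x m =
      -(v.mult * Real.log ‖(x (Multiplicative.ofAdd m) : 𝔸[F]).1 v‖) := by
  change -Real.log (‖(x (Multiplicative.ofAdd m) : 𝔸[F]).1 v‖ ^ v.mult) / Real.log (Real.exp 1) = _
  rw [Real.log_exp, div_one, Real.log_pow]

theorem finCoord_apply (v : HeightOneSpectrum (𝓞 F)) (x : TorusPoints M 𝔸[F]) (m : M) :
    finCoord v x m =
      -Real.log ‖(x (Multiplicative.ofAdd m) : 𝔸[F]).2 v‖ / Real.log (residueCard v) := rfl

theorem one_lt_residueCard (v : HeightOneSpectrum (𝓞 F)) : 1 < residueCard v := by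
  exact Nat.one_lt_cast.2 (HeightOneSpectrum.one_lt_absNorm v)

theorem adele_snd_ne_zero (u : 𝔸[F]ˣ) (v : HeightOneSpectrum (𝓞 F)) : (u : 𝔸[F]).2 v ≠ 0 :=
  (Units.map (projFin v : 𝔸[F] →* v.adicCompletion F) u).ne_zero

theorem adele_fst_ne_zero (u : 𝔸[F]ˣ) (v : InfinitePlace F) : (u : 𝔸[F]).1 v ≠ 0 :=
  (Units.map (projInf v : 𝔸[F] →* v.Completion) u).ne_zero

theorem norm_eq_one_iff_valued (v : HeightOneSpectrum (𝓞 F)) (y : v.adicCompletion F) :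
    ‖y‖ = 1 ↔ Valued.v y = 1 := by
  rw [FinitePlace.norm_def, NNReal.coe_eq_one,
    WithZeroMulInt.toNNReal_eq_one_iff _ (HeightOneSpectrum.absNorm_ne_zero v)
      (HeightOneSpectrum.one_lt_absNorm_nnreal v).ne']

theorem exists_log_norm_eq (v : HeightOneSpectrum (𝓞 F)) {y : v.adicCompletion F} (hy : y ≠ 0) :
    ∃ k : ℤ, Real.log ‖y‖ = k * Real.log (residueCard v) := by
  have h0 : Valued.v y ≠ 0 := (Valuation.ne_zero_iff _).2 hy
  refine ⟨Multiplicative.toAdd (WithZero.unzero h0), ?_⟩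
  rw [FinitePlace.norm_def, WithZeroMulInt.toNNReal_neg_apply _ h0]
  push_cast
  rw [Real.log_zpow]
  rfl

theorem exists_toReal_eq {x : CochR M} (h : ∀ m, ∃ k : ℤ, x m = k) :
    ∃ n : Coch M, n.toReal = x := by
  choose f hf using h
  refine ⟨AddMonoidHom.toIntLinearMap ⟨⟨f, ?_⟩, fun a b => ?_⟩, ?_⟩
  · have := hf 0
    rw [map_zero] at this
    exact_mod_cast this.symm
  · have := hf (a + b)
    rw [map_add, hf, hf] at this
    exact_mod_cast this.symm
  · ext m
    exact (hf m).symm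

/-- The normalized absolute value at `v` takes its nonzero values in the powers of `q_v`, so
division by `log q_v` gives integers. -/
theorem exists_toReal_eq_finCoord (v : HeightOneSpectrum (𝓞 F)) (x : TorusPoints M 𝔸[F]) :
    ∃ n : Coch M, n.toReal = finCoord v x := by
  refine exists_toReal_eq fun m => ?_
  obtain ⟨k, hk⟩ := exists_log_norm_eq v (adele_snd_ne_zero (x (Multiplicative.ofAdd m)) v)
  refine ⟨-k, ?_⟩
  have := (Real.log_pos (one_lt_residueCard v)).ne'
  rw [finCoord_apply, hk]
  field_simp
  push_cast
  ring

section

variable [Module.Free ℤ M] [Module.Finite ℤ M]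

theorem finite_support_finCoord (x : TorusPoints M 𝔸[F]) :
    {v : HeightOneSpectrum (𝓞 F) | finCoord v x ≠ 0}.Finite := by
  let b := Module.Free.chooseBasis ℤ M
  have h : ∀ i, ∀ᶠ v in Filter.cofinite,
      ‖((x (Multiplicative.ofAdd (b i)) : 𝔸[F]ˣ) : 𝔸[F]).2 v‖ = 1 := by
    intro i
    let snd : 𝔸[F] →* FiniteAdeleRing (𝓞 F) F :=
      { toFun := fun a => a.2, map_one' := rfl, map_mul' := fun _ _ => rfl }
    let u : (FiniteAdeleRing (𝓞 F) F)ˣ := Units.map snd (x (Multiplicative.ofAdd (b i)))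
    filter_upwards [(FiniteAdeleRing.isUnit_iff.1 u.isUnit).2] with v hv
    exact (norm_eq_one_iff_valued v _).2 hv
  rw [← Filter.eventually_all] at h
  refine (Filter.eventually_cofinite.1 h).subset fun v hv hh => hv (b.ext fun i => ?_)
  rw [finCoord_apply, hh i]
  simp

/-- The family `(x̄_v)_v` at the finite places, with values in the lattice `N`. -/
def divisor (x : TorusPoints M 𝔸[F]) : HeightOneSpectrum (𝓞 F) →₀ Coch M :=
  Finsupp.ofSupportFinite (fun v => (exists_toReal_eq_finCoord v x).choose) <|
    (finite_support_finCoord x).subset fun v hv h => hv <| Fan.toReal_injective <| by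
      rw [(exists_toReal_eq_finCoord v x).choose_spec, h]
      ext; simp [Fan.toReal_apply]

theorem toReal_divisor (x : TorusPoints M 𝔸[F]) (v : HeightOneSpectrum (𝓞 F)) :
    (divisor x v).toReal = finCoord v x := (exists_toReal_eq_finCoord v x).choose_spec

theorem divisor_mul (x y : TorusPoints M 𝔸[F]) : divisor (x * y) = divisor x + divisor y := by
  refine Finsupp.ext fun v => Fan.toReal_injective ?_
  rw [toReal_divisor, finCoord_mul, ← toReal_divisor, ← toReal_divisor]
  ext m
  simp [Fan.toReal_apply]

/-- The points of `T(F)` that are units at the finite places and bounded at the archimedean ones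
form a finite set. -/
theorem finite_bounded_units :
    {u : TorusPoints M F | divisor (diag M F u) = 0 ∧ ∀ v i,
      |infCoord v (diag M F u) (Module.Free.chooseBasis ℤ M i)| ≤ 1}.Finite := by
  let b := Module.Free.chooseBasis ℤ M
  have hE := Embeddings.finite_of_norm_le F ℂ (Real.exp 1)
  have hpi : (Set.univ.pi fun _ : Module.Free.ChooseBasisIndex ℤ M =>
      {x : F | IsIntegral ℤ x ∧ ∀ φ : F →+* ℂ, ‖φ x‖ ≤ Real.exp 1}).Finite :=
    Set.Finite.pi fun _ => hE
  refine Set.Finite.of_finite_image (f := fun u i => (u (Multiplicative.ofAdd (b i)) : F))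
    (hpi.subset ?_) ?_
  · rintro _ ⟨u, ⟨hfin, hinf⟩, rfl⟩ i -
    refine ⟨?_, fun φ => ?_⟩
    -- A trivial divisor means valuation `1` at every finite place, hence integrality.
    · obtain ⟨y, hy⟩ := HeightOneSpectrum.mem_integers_of_valuation_le_one (R := 𝓞 F) F
        (u (Multiplicative.ofAdd (b i)) : F) fun v => by
          have h1 : finCoord v (diag M F u) (b i) = 0 := by
            rw [← toReal_divisor, hfin]
            simp [Fan.toReal_apply]
          rw [finCoord_apply, div_eq_zero_iff, neg_eq_zero,
            or_iff_left (Real.log_pos (one_lt_residueCard v)).ne'] at h1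
          have h2 := Real.eq_one_of_pos_of_log_eq_zero
            (norm_pos_iff.2 (adele_snd_ne_zero _ v)) h1
          rw [norm_eq_one_iff_valued] at h2
          rw [← HeightOneSpectrum.valuedAdicCompletion_eq_valuation']
          exact h2.le
      change IsIntegral ℤ (u (Multiplicative.ofAdd (b i)) : F)
      exact hy ▸ RingOfIntegers.isIntegral_coe y
    · let v := InfinitePlace.mk φ
      have h1 := hinf v i
      rw [infCoord_apply, abs_neg, abs_mul, Nat.abs_cast] at h1
      -- Since `v.mult ≥ 1`, dropping it from the bound on `v.mult * log` is harmless.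
      have h2 : |Real.log ‖(diag M F u (Multiplicative.ofAdd (b i)) : 𝔸[F]).1 v‖| ≤ 1 := by
        refine le_trans (le_mul_of_one_le_left (abs_nonneg _) ?_) h1
        exact_mod_cast v.mult_pos
      have h3 : ‖(diag M F u (Multiplicative.ofAdd (b i)) : 𝔸[F]).1 v‖ =
          ‖φ (u (Multiplicative.ofAdd (b i)) : F)‖ := by
        change ‖((u (Multiplicative.ofAdd (b i)) : F) : v.Completion)‖ = _
        exact (InfinitePlace.Completion.norm_coe v _)
      rw [h3] at h2
      have h4 : 0 < ‖φ (u (Multiplicative.ofAdd (b i)) : F)‖ :=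
        norm_pos_iff.2 ((map_ne_zero φ).2 (Units.ne_zero _))
      exact (Real.log_le_iff_le_exp h4).1 (le_of_abs_le h2)
  · intro u _ w _ h
    have h1 : (MonoidHom.toAdditive u).toIntLinearMap = (MonoidHom.toAdditive w).toIntLinearMap :=
      b.ext fun i => congrArg Additive.ofMul (Units.ext (congrFun h i))
    exact MonoidHom.ext fun m => congrArg Additive.toMul (LinearMap.congr_fun h1 m.toAdd)

end

end ToricHeight
end

/-! ### A summable majorant of the height -/

noncomputable section

namespace ToricHeight

variable {M : Type*} [AddCommGroup M] [Module.Free ℤ M] [Module.Finite ℤ M]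
  {F : Type*} [Field F] [NumberField F] {Δ : Fan M}

/-- The archimedean part of the majorant of the height. -/
def infMajorant (c : ℝ) (x : TorusPoints M 𝔸[F]) : ℝ :=
  ∏ p : InfinitePlace F × Module.Free.ChooseBasisIndex ℤ M,
    Real.exp (-(c * |infCoord p.1 x (Module.Free.chooseBasis ℤ M p.2)|))

/-- The local factor at a finite place of the majorant of the height. -/
def finFactor (hreg : Δ.IsRegular) (s : ℝ) (v : HeightOneSpectrum (𝓞 F)) (n : Coch M) : ℝ :=
  Real.exp (-(s * (Δ.phiSigma hreg).1 n.toReal) * Real.log (residueCard v))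

theorem infMajorant_pos (c : ℝ) (x : TorusPoints M 𝔸[F]) : 0 < infMajorant c x :=
  Finset.prod_pos fun _ _ => Real.exp_pos _

theorem finsupp_prod_finFactor_pos (hreg : Δ.IsRegular) (s : ℝ)
    (D : HeightOneSpectrum (𝓞 F) →₀ Coch M) : 0 < D.prod (finFactor hreg s) :=
  Finset.prod_pos fun _ _ => Real.exp_pos _

theorem finFactor_zero (hreg : Δ.IsRegular) (hcomp : Δ.IsComplete) (s : ℝ)
    (v : HeightOneSpectrum (𝓞 F)) : finFactor hreg s v (0 : Coch M) = 1 := by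
  have : (0 : Coch M).toReal = 0 := by ext; simp [Fan.toReal_apply]
  simp [finFactor, this, Fan.phiSigma_zero hreg hcomp]

omit [Module.Free ℤ M] [Module.Finite ℤ M] in
theorem norm_localHeightInf (v : InfinitePlace F) (x : TorusPoints M 𝔸[F]) (φ : Δ.PL ℂ) :
    ‖localHeightInf v (TorusPoints.map (projInf v) x) φ‖ =
      Real.exp (-(Fan.PL.re φ).1 (infCoord v x)) := by
  rw [localHeightInf, Complex.norm_exp, Real.log_exp, Complex.ofReal_one, mul_one]
  rfl

omit [Module.Free ℤ M] [Module.Finite ℤ M] in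
theorem norm_localHeightFin (v : HeightOneSpectrum (𝓞 F)) (x : TorusPoints M 𝔸[F])
    (φ : Δ.PL ℂ) :
    ‖localHeightFin v (TorusPoints.map (projFin v) x) φ‖ =
      Real.exp (-(Fan.PL.re φ).1 (finCoord v x) * Real.log (residueCard v)) := by
  rw [localHeightFin, Complex.norm_exp, Complex.re_mul_ofReal]
  rfl

theorem prod_norm_localHeightInf_le {s c : ℝ} {φ : Δ.PL ℂ}
    (h : ∀ y : CochR M,
      s * c * ∑ i, |y (Module.Free.chooseBasis ℤ M i)| ≤ (Fan.PL.re φ).1 y)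
    (x : TorusPoints M 𝔸[F]) :
    ‖∏ v : InfinitePlace F, localHeightInf v (TorusPoints.map (projInf v) x) φ‖ ≤
      infMajorant (s * c) x := by
  rw [norm_prod, infMajorant, Fintype.prod_prod_type]
  refine Finset.prod_le_prod (fun _ _ => norm_nonneg _) fun v _ => ?_
  rw [norm_localHeightInf]
  refine (Real.exp_le_exp.2 (neg_le_neg (h (infCoord v x)))).trans_eq ?_
  rw [Finset.mul_sum, ← Finset.sum_neg_distrib, Real.exp_sum]

theorem norm_finprod_localHeightFin_le (hreg : Δ.IsRegular) (hcomp : Δ.IsComplete) {s : ℝ}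
    {φ : Δ.PL ℂ} (h : ∀ y : CochR M, s * (Δ.phiSigma hreg).1 y ≤ (Fan.PL.re φ).1 y)
    (x : TorusPoints M 𝔸[F]) :
    ‖∏ᶠ v : HeightOneSpectrum (𝓞 F), localHeightFin v (TorusPoints.map (projFin v) x) φ‖ ≤
      (divisor x).prod (finFactor hreg s) := by
  have h0 : φ.1 0 = 0 := by
    obtain ⟨σ, hσ, h⟩ := hcomp 0
    obtain ⟨l, hl⟩ := φ.2 σ hσ
    rw [hl 0 h, map_zero]
  have hsub : (Function.mulSupport fun v : HeightOneSpectrum (𝓞 F) =>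
      localHeightFin v (TorusPoints.map (projFin v) x) φ) ⊆ ((divisor x).support : Set _) := by
    intro v hv
    rw [Finset.mem_coe, Finsupp.mem_support_iff]
    intro h
    refine hv ?_
    have : finCoord v x = 0 := by
      rw [← toReal_divisor, h]; ext; simp [Fan.toReal_apply]
    rw [finCoord] at this
    simp only [localHeightFin, this, h0, neg_zero, zero_mul, Complex.exp_zero]
  rw [finprod_eq_prod_of_mulSupport_subset _ hsub, norm_prod, Finsupp.prod]
  refine Finset.prod_le_prod (fun _ _ => norm_nonneg _) fun v _ => ?_
  rw [norm_localHeightFin, finFactor, toReal_divisor]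
  exact Real.exp_le_exp.2 (mul_le_mul_of_nonneg_right (neg_le_neg (h _))
    (Real.log_pos (one_lt_residueCard v)).le)

/-- The bound `Re φ ≥ s φ_Σ` is kept in full at the finite places, where the Euler product needs `s
> 1`. At the archimedean places the weaker bound by a norm suffices. -/
theorem norm_height_le (hreg : Δ.IsRegular) (hcomp : Δ.IsComplete) {s c : ℝ} (hs : 0 ≤ s)
    (hc : ∀ x : CochR M,
      c * ∑ i, |x (Module.Free.chooseBasis ℤ M i)| ≤ (Δ.phiSigma hreg).1 x)
    {φ : Δ.PL ℂ} (hφ : ∀ e ∈ Δ.rays, s ≤ (Fan.PL.re φ).1 e.toReal) (x : TorusPoints M 𝔸[F]) :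
    ‖height x φ‖ ≤ infMajorant (s * c) x * (divisor x).prod (finFactor hreg s) := by
  have hle := Fan.mul_phiSigma_le hreg hcomp hφ
  rw [height, norm_mul]
  refine mul_le_mul (prod_norm_localHeightInf_le (fun y => ?_) x)
    (norm_finprod_localHeightFin_le hreg hcomp hle x) (norm_nonneg _) (infMajorant_pos _ _).le
  rw [mul_assoc]
  exact (mul_le_mul_of_nonneg_left (hc _) hs).trans (hle _)

theorem summable_finsupp_prod_finFactor (hreg : Δ.IsRegular) (hcomp : Δ.IsComplete) {s : ℝ}
    (hs : 1 < s) :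
    Summable fun D : HeightOneSpectrum (𝓞 F) →₀ Coch M => D.prod (finFactor hreg s) := by
  obtain ⟨C, hC⟩ := Fan.exists_sum_rpow_phiSigma_le hreg hcomp (zero_lt_one.trans hs)
  refine summable_finsupp_prod (fun _ _ => (Real.exp_pos _).le) (finFactor_zero hreg hcomp s)
    ((summable_absNorm_rpow hs).mul_left C) fun v T hT => hC _ ?_ T hT
  exact Nat.ofNat_le_cast.2 (HeightOneSpectrum.one_lt_absNorm v)

/-- Rounding moves each coordinate by at most `1`, at the cost of a factor `exp c`. -/
theorem infMajorant_le_of_floor (c : ℝ) (hc : 0 ≤ c) (x : TorusPoints M 𝔸[F]) :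
    infMajorant c x ≤ (∏ _p : InfinitePlace F × Module.Free.ChooseBasisIndex ℤ M, Real.exp c) *
      ∏ p : InfinitePlace F × Module.Free.ChooseBasisIndex ℤ M,
        Real.exp (-(c * |(⌊infCoord p.1 x (Module.Free.chooseBasis ℤ M p.2)⌋ : ℝ)|)) := by
  rw [infMajorant, ← Finset.prod_mul_distrib]
  refine Finset.prod_le_prod (fun _ _ => (Real.exp_pos _).le) fun p _ => ?_
  set r := infCoord p.1 x (Module.Free.chooseBasis ℤ M p.2)
  rw [← Real.exp_add, Real.exp_le_exp]
  have h1 : |(⌊r⌋ : ℝ)| ≤ |r| + 1 := by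
    have h2 : |(⌊r⌋ : ℝ) - r| ≤ 1 := by
      rw [abs_sub_le_iff]
      constructor <;> linarith [Int.floor_le r, Int.lt_floor_add_one r]
    have := abs_sub_abs_le_abs_sub (⌊r⌋ : ℝ) r
    linarith
  have := mul_le_mul_of_nonneg_left h1 hc
  linarith

/-- The integral parts of the coordinates of an adelic point. -/
def floorCoord (x : TorusPoints M 𝔸[F]) :
    (InfinitePlace F × Module.Free.ChooseBasisIndex ℤ M → ℤ) ×
      (HeightOneSpectrum (𝓞 F) →₀ Coch M) :=
  (fun p => ⌊infCoord p.1 x (Module.Free.chooseBasis ℤ M p.2)⌋, divisor x)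

/-- The coordinates are additive, so those of `x * w⁻¹` are differences in which the translation by
`t` cancels; reals with equal floors differ by less than `1`. -/
theorem mul_inv_mem_of_floorCoord_eq {t : TorusPoints M 𝔸[F]} {x w : TorusPoints M F}
    (h : floorCoord (diag M F x * t) = floorCoord (diag M F w * t)) :
    divisor (diag M F (x * w⁻¹)) = 0 ∧ ∀ v i,
      |infCoord v (diag M F (x * w⁻¹)) (Module.Free.chooseBasis ℤ M i)| ≤ 1 := by
  have hxw : diag M F x * t = diag M F (x * w⁻¹) * (diag M F w * t) := by
    have h1 : diag M F x = diag M F (x * w⁻¹) * diag M F w :=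
      (congrArg (diag M F) (inv_mul_cancel_right x w)).symm.trans (map_mul _ _ _)
    rw [h1]
    exact mul_assoc (diag M F (x * w⁻¹)) (diag M F w) t
  rw [hxw] at h
  generalize diag M F (x * w⁻¹) = a at h ⊢
  generalize diag M F w * t = y at h
  constructor
  · have h2 : divisor (a * y) = divisor y := congrArg Prod.snd h
    rwa [divisor_mul, add_eq_right] at h2
  · intro v i
    have h1 : ⌊infCoord v (a * y) (Module.Free.chooseBasis ℤ M i)⌋ =
        ⌊infCoord v y (Module.Free.chooseBasis ℤ M i)⌋ := congrFun (congrArg Prod.fst h) (v, i)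
    have h2 := Int.abs_sub_lt_one_of_floor_eq_floor h1
    rw [infCoord_mul, LinearMap.add_apply, add_sub_cancel_right] at h2
    exact h2.le

/-- Division by one element `w` of a fibre embeds it in the finite set of bounded units, which does
not depend on `z`. -/
theorem exists_card_fiber_floorCoord_le (t : TorusPoints M 𝔸[F]) :
    ∃ C : ℕ, ∀ z, ∀ S : Finset (TorusPoints M F),
      (∀ x ∈ S, floorCoord (diag M F x * t) = z) → S.card ≤ C := by
  refine ⟨(finite_bounded_units (M := M) (F := F)).toFinset.card, fun z S hS => ?_⟩
  rcases S.eq_empty_or_nonempty with rfl | ⟨w, hw⟩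
  · exact Nat.zero_le _
  refine Finset.card_le_card_of_injOn (fun x => x * w⁻¹) (fun x hx => ?_)
    (mul_left_injective w⁻¹).injOn
  exact (Set.Finite.mem_toFinset _).2 (mul_inv_mem_of_floorCoord_eq ((hS x hx).trans (hS w hw).symm))

theorem summable_majorant (hreg : Δ.IsRegular) (hcomp : Δ.IsComplete) {s c : ℝ}
    (hs : 1 < s) (hc : 0 < c) (t : TorusPoints M 𝔸[F]) :
    Summable fun x : TorusPoints M F => infMajorant c (diag M F x * t) *
      (divisor (diag M F x * t)).prod (finFactor hreg s) := by
  have hinf : Summable fun z : InfinitePlace F × Module.Free.ChooseBasisIndex ℤ M → ℤ =>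
      (∏ _p : InfinitePlace F × Module.Free.ChooseBasisIndex ℤ M, Real.exp c) *
        ∏ p, Real.exp (-(c * |(z p : ℝ)|)) :=
    (summable_pi_prod (f := fun _ (k : ℤ) => Real.exp (-(c * |(k : ℝ)|)))
      (fun _ _ => (Real.exp_pos _).le) (by simp)
      fun _ => summable_exp_neg_mul_abs_int hc).mul_left _
  have hinf0 : ∀ z : InfinitePlace F × Module.Free.ChooseBasisIndex ℤ M → ℤ,
      0 ≤ (∏ _p : InfinitePlace F × Module.Free.ChooseBasisIndex ℤ M, Real.exp c) *
        ∏ p, Real.exp (-(c * |(z p : ℝ)|)) := fun _ => by positivity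
  have hg := hinf.mul_of_nonneg (summable_finsupp_prod_finFactor (F := F) hreg hcomp hs)
    hinf0 fun D => (finsupp_prod_finFactor_pos hreg s D).le
  obtain ⟨C, hC⟩ := exists_card_fiber_floorCoord_le t
  exact summable_of_card_fiber_le (fun x => floorCoord (diag M F x * t)) C
    (fun x => (mul_pos (infMajorant_pos _ _) (finsupp_prod_finFactor_pos hreg s _)).le) hg
    (fun z => mul_nonneg (hinf0 _) (finsupp_prod_finFactor_pos hreg s _).le)
    (fun x => mul_le_mul_of_nonneg_right (infMajorant_le_of_floor c hc.le _)
      (finsupp_prod_finFactor_pos hreg s _).le) hC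

/-! ### Dependence on the adelic translation -/

theorem isOpen_setOf_valued_le_one :
    IsOpen {a : 𝔸[F] | ∀ v : HeightOneSpectrum (𝓞 F), a.2 v ∈ v.adicCompletionIntegers F} := by
  have h : IsOpen {f : FiniteAdeleRing (𝓞 F) F |
      ∀ v : HeightOneSpectrum (𝓞 F), f v ∈ v.adicCompletionIntegers F} :=
    RestrictedProduct.isOpen_forall_mem (R := fun v : HeightOneSpectrum (𝓞 F) => v.adicCompletion F)
      (A := fun v => (v.adicCompletionIntegers F : Set (v.adicCompletion F)))
      fun v => Valued.isOpen_valuationSubring _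
  exact h.preimage (continuous_snd : Continuous
    (Prod.snd : InfiniteAdeleRing F × FiniteAdeleRing (𝓞 F) F → FiniteAdeleRing (𝓞 F) F))

/-- Near `u₀` both `u / u₀` and its inverse are integral at every finite place, so the quotient is a
local unit at all of them simultaneously. The topology of the unit group is used to control the
inverse. -/
theorem eventually_norm_snd_eq (u₀ : 𝔸[F]ˣ) :
    ∀ᶠ u : 𝔸[F]ˣ in nhds u₀, ∀ v : HeightOneSpectrum (𝓞 F),
      ‖(u : 𝔸[F]).2 v‖ = ‖(u₀ : 𝔸[F]).2 v‖ := by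
  have hO := isOpen_setOf_valued_le_one (F := F)
  have h1 : Continuous fun u : 𝔸[F]ˣ => ((u * u₀⁻¹ : 𝔸[F]ˣ) : 𝔸[F]) :=
    Units.continuous_val.comp (continuous_mul_const _)
  have h2 : Continuous fun u : 𝔸[F]ˣ => (((u * u₀⁻¹ : 𝔸[F]ˣ)⁻¹ : 𝔸[F]ˣ) : 𝔸[F]) :=
    Units.continuous_val.comp (continuous_mul_const _).inv
  have hmem : (1 : 𝔸[F]) ∈
      {a : 𝔸[F] | ∀ v : HeightOneSpectrum (𝓞 F), a.2 v ∈ v.adicCompletionIntegers F} :=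
    fun v => one_mem (v.adicCompletionIntegers F)
  filter_upwards [(hO.preimage h1).mem_nhds (by simpa using hmem),
    (hO.preimage h2).mem_nhds (by simpa using hmem)] with u hu hu' v
  have hv : Valued.v ((projFin v) ((u * u₀⁻¹ : 𝔸[F]ˣ) : 𝔸[F])) ≤ 1 := hu v
  have hv' : Valued.v ((projFin v) (((u * u₀⁻¹)⁻¹ : 𝔸[F]ˣ) : 𝔸[F])) ≤ 1 := hu' v
  have hmul : Valued.v ((projFin v) ((u * u₀⁻¹ : 𝔸[F]ˣ) : 𝔸[F])) *
      Valued.v ((projFin v) (((u * u₀⁻¹)⁻¹ : 𝔸[F]ˣ) : 𝔸[F])) = 1 := by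
    rw [← map_mul, ← map_mul, Units.mul_inv, map_one, map_one]
  have hone : Valued.v ((projFin v) ((u * u₀⁻¹ : 𝔸[F]ˣ) : 𝔸[F])) = 1 :=
    le_antisymm hv (hmul ▸ mul_le_of_le_one_right' hv')
  have : (projFin v) (u : 𝔸[F]) =
      (projFin v) ((u * u₀⁻¹ : 𝔸[F]ˣ) : 𝔸[F]) * (projFin v) (u₀ : 𝔸[F]) := by
    rw [← map_mul, ← Units.val_mul, inv_mul_cancel_right]
  change ‖(projFin v) (u : 𝔸[F])‖ = ‖(projFin v) (u₀ : 𝔸[F])‖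
  rw [this, norm_mul, (norm_eq_one_iff_valued v _).2 hone, one_mul]

theorem continuous_log_norm_fst (v : InfinitePlace F) :
    Continuous fun u : 𝔸[F]ˣ => Real.log ‖(u : 𝔸[F]).1 v‖ := by
  have h : Continuous fun a : 𝔸[F] => a.1 v :=
    (continuous_apply (A := fun v : InfinitePlace F => v.Completion) v).comp
      (continuous_fst : Continuous
        (Prod.fst : InfiniteAdeleRing F × FiniteAdeleRing (𝓞 F) F → InfiniteAdeleRing F))
  exact ((h.comp Units.continuous_val).norm).log fun u => (norm_pos_iff.2 (adele_fst_ne_zero u v)).ne'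

omit [Module.Free ℤ M] [Module.Finite ℤ M] in
theorem continuous_torusPoints_apply (m : M) :
    Continuous fun t : TorusPoints M 𝔸[F] => t (Multiplicative.ofAdd m) :=
  (continuous_apply (Multiplicative.ofAdd m)).comp continuous_induced_dom

theorem eventually_divisor_eq (t₀ : TorusPoints M 𝔸[F]) :
    ∀ᶠ t in nhds t₀, divisor t = divisor t₀ := by
  have h : ∀ i, ∀ᶠ t in nhds t₀, ∀ v : HeightOneSpectrum (𝓞 F),
      finCoord v t (Module.Free.chooseBasis ℤ M i) =
        finCoord v t₀ (Module.Free.chooseBasis ℤ M i) := fun i => by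
    filter_upwards [(continuous_torusPoints_apply (Module.Free.chooseBasis ℤ M i)).continuousAt
      (eventually_norm_snd_eq (t₀ (Multiplicative.ofAdd (Module.Free.chooseBasis ℤ M i))))]
      with t ht v
    rw [finCoord_apply, finCoord_apply, ht v]
  filter_upwards [Filter.eventually_all.2 h] with t ht
  refine Finsupp.ext fun v => Fan.toReal_injective ?_
  rw [toReal_divisor, toReal_divisor]
  exact (Module.Free.chooseBasis ℤ M).ext fun i => ht i v

theorem eventually_abs_infCoord_sub_le (t₀ : TorusPoints M 𝔸[F]) :
    ∀ᶠ t in nhds t₀, ∀ p : InfinitePlace F × Module.Free.ChooseBasisIndex ℤ M,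
      |infCoord p.1 t (Module.Free.chooseBasis ℤ M p.2) -
        infCoord p.1 t₀ (Module.Free.chooseBasis ℤ M p.2)| ≤ 1 := by
  refine Filter.eventually_all.2 fun p => ?_
  have hcont : Continuous fun t : TorusPoints M 𝔸[F] =>
      infCoord p.1 t (Module.Free.chooseBasis ℤ M p.2) := by
    simp only [infCoord_apply]
    exact (continuous_const.mul
      ((continuous_log_norm_fst p.1).comp (continuous_torusPoints_apply _))).neg
  filter_upwards [hcont.continuousAt (Metric.closedBall_mem_nhds _ one_pos)] with t ht
  exact ht

theorem infMajorant_le_of_abs_sub_le {c : ℝ} (hc : 0 ≤ c) (x : TorusPoints M 𝔸[F])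
    {t t₀ : TorusPoints M 𝔸[F]}
    (h : ∀ p : InfinitePlace F × Module.Free.ChooseBasisIndex ℤ M,
      |infCoord p.1 t (Module.Free.chooseBasis ℤ M p.2) -
        infCoord p.1 t₀ (Module.Free.chooseBasis ℤ M p.2)| ≤ 1) :
    infMajorant c (x * t) ≤
      (∏ _p : InfinitePlace F × Module.Free.ChooseBasisIndex ℤ M, Real.exp c) *
        infMajorant c (x * t₀) := by
  rw [infMajorant, infMajorant, ← Finset.prod_mul_distrib]
  refine Finset.prod_le_prod (fun _ _ => (Real.exp_pos _).le) fun p _ => ?_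
  rw [← Real.exp_add, Real.exp_le_exp, infCoord_mul, infCoord_mul, LinearMap.add_apply,
    LinearMap.add_apply]
  have h1 := h p
  set a := infCoord p.1 x (Module.Free.chooseBasis ℤ M p.2)
  set y := infCoord p.1 t (Module.Free.chooseBasis ℤ M p.2)
  set z := infCoord p.1 t₀ (Module.Free.chooseBasis ℤ M p.2)
  have h2 : |a + z| ≤ |a + y| + 1 := by
    have := abs_sub_abs_le_abs_sub (a + z) (a + y)
    rw [add_sub_add_left_eq_sub, abs_sub_comm z y] at this
    linarith
  have := mul_le_mul_of_nonneg_left h2 hc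
  linarith

/-- On compact subsets the series of heights is dominated by a convergent series. -/
theorem exists_summable_norm_height_le (hreg : Δ.IsRegular) (hcomp : Δ.IsComplete)
    {K : Set (Δ.PL ℝ × TorusPoints M 𝔸[F])} (hK : IsCompact K)
    (hKsub : K ⊆ (Δ.phiSigma hreg +ᵥ Δ.PLpos) ×ˢ Set.univ) :
    ∃ B : TorusPoints M F → ℝ, Summable B ∧ ∀ x (φ : Δ.PL ℂ) (t : TorusPoints M 𝔸[F]),
      (Fan.PL.re φ, t) ∈ K → ‖height (diag M F x * t) φ‖ ≤ B x := by
  classical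
  obtain ⟨s, hs, hKs⟩ := Fan.exists_one_lt_forall_le hreg hK hKsub
  obtain ⟨c, hc, hφ⟩ := Fan.exists_le_phiSigma hreg hcomp (Module.Free.chooseBasis ℤ M)
  have hs0 : 0 < s := zero_lt_one.trans hs
  let A : ℝ := ∏ _p : InfinitePlace F × Module.Free.ChooseBasisIndex ℤ M, Real.exp (s * c)
  let b : TorusPoints M 𝔸[F] → TorusPoints M F → ℝ := fun t x =>
    infMajorant (s * c) (diag M F x * t) * (divisor (diag M F x * t)).prod (finFactor hreg s)
  have hb0 : ∀ t x, 0 ≤ b t x := fun t x =>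
    (mul_pos (infMajorant_pos _ _) (finsupp_prod_finFactor_pos hreg s _)).le
  -- On a neighbourhood of `t₀` the finite part of the majorant is unchanged and the archimedean
  -- part grows by at most the factor `A`.
  have hloc : ∀ t₀ ∈ Prod.snd '' K, {t | ∀ x, b t x ≤ A * b t₀ x} ∈ nhds t₀ := fun t₀ _ => by
    filter_upwards [eventually_divisor_eq t₀, eventually_abs_infCoord_sub_le t₀] with t h1 h2 x
    simp only [b]
    rw [divisor_mul, divisor_mul, h1, ← mul_assoc]
    exact mul_le_mul_of_nonneg_right (infMajorant_le_of_abs_sub_le (mul_pos hs0 hc).le _ h2)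
      (finsupp_prod_finFactor_pos hreg s _).le
  obtain ⟨S, -, hS⟩ := (hK.image continuous_snd).elim_nhds_subcover _ hloc
  -- Summing over the finitely many centres of a subcover gives a bound that no longer depends on
  -- `t`.
  refine ⟨fun x => ∑ t ∈ S, A * b t x, summable_sum fun t _ =>
    (summable_majorant hreg hcomp hs (mul_pos hs0 hc) t).mul_left A, fun x φ t ht => ?_⟩
  obtain ⟨t₀, ht₀, hmem⟩ := Set.mem_iUnion₂.1 (hS ⟨_, ht, rfl⟩)
  calc ‖height (diag M F x * t) φ‖ ≤ b t x :=
        norm_height_le hreg hcomp hs0.le hφ (hKs _ ht) _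
    _ ≤ A * b t₀ x := hmem x
    _ ≤ ∑ t ∈ S, A * b t x := Finset.single_le_sum (f := fun t => A * b t x)
        (fun t _ => mul_nonneg (by positivity) (hb0 t x)) ht₀

end ToricHeight
end

/-! ### Uniform convergence by the M-test -/

theorem proposition3p4 {F : Type*} [Field F] [NumberField F]
    {M : Type*} [AddCommGroup M] [Module.Free ℤ M] [Module.Finite ℤ M]
    (Δ : Fan M) (hreg : Δ.IsRegular) (hcomp : Δ.IsComplete)
    (K : Set (Δ.PL ℝ × TorusPoints M 𝔸[F])) (hK : IsCompact K)
    (hKsub : K ⊆ (Δ.phiSigma hreg +ᵥ Δ.PLpos) ×ˢ Set.univ) :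
    (∀ (φ : Δ.PL ℂ) (t : TorusPoints M 𝔸[F]), (Fan.PL.re φ, t) ∈ K →
      Summable fun x : TorusPoints M F => ‖height (diag M F x * t) φ‖) ∧
    HasSumUniformlyOn
      (fun (x : TorusPoints M F) (p : Δ.PL ℂ × TorusPoints M 𝔸[F]) =>
        ‖height (diag M F x * p.2) p.1‖)
      (fun p => ∑' x : TorusPoints M F, ‖height (diag M F x * p.2) p.1‖)
      {p | (Fan.PL.re p.1, p.2) ∈ K} ∧
    HasSumUniformlyOn
      (fun (x : TorusPoints M F) (p : Δ.PL ℂ × TorusPoints M 𝔸[F]) =>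
        height (diag M F x * p.2) p.1)
      (fun p => ∑' x : TorusPoints M F, height (diag M F x * p.2) p.1)
      {p | (Fan.PL.re p.1, p.2) ∈ K} := by
  obtain ⟨B, hB, hle⟩ := exists_summable_norm_height_le (F := F) hreg hcomp hK hKsub
  refine ⟨fun φ t ht => hB.of_nonneg_of_le (fun _ => norm_nonneg _) fun x => hle x φ t ht,
    HasSumUniformlyOn.of_norm_le_summable hB fun x p hp => ?_,
    HasSumUniformlyOn.of_norm_le_summable hB fun x p hp => hle x p.1 p.2 hp⟩
  rw [norm_norm]
  exact hle x p.1 p.2 hp
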